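/- A function $f:\,]0,\infty[\,\to\mathbb{R}$ is \emph{completely monotone} if it is infinitely differentiable and $(-1)^n f^{(n)}(y)\ge 0$ for all $y>0$ and all integers $n\ge 0$. It is a \emph{Bernstein function} if it is non-negative and differentiable and its derivative $f'$ is completely monotone. It is a \emph{complete Bernstein function} if there is a Bernstein function $g$ such that $f(y)=y^2\int_0^\infty e^{-yt}g(t)\,dt$ for all $y>0$, the integral being absolutely convergent. Let $c>0$ and $a\ge 0$ be real numbers, and for real $\alpha$ and $p>0$ let $$Q(p)=\frac{c^2}{\left[1+a\,p^{\alpha-1}\right]^2}.$$ (i) If $0\le\alpha\le 1$, then the function $Q^{1/2}$ is a complete Bernstein function. (ii) If $1/2\le\alpha\le 1$, then the function $Q$ is a complete Bernstein function. -/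

import Mathlib

open scoped ContDiff

/-- `f` is completely monotone on `]0, ∞[`: it is smooth there and `(-1)ⁿ Dⁿ f ≥ 0` for all `n ≥ 0`.
Only the values of `f` on `]0, ∞[` matter, since this set is open. -/
def IsCompletelyMonotone (f : ℝ → ℝ) : Prop :=
  ContDiffOn ℝ ∞ f (Set.Ioi 0) ∧
    ∀ (n : ℕ) (y : ℝ), 0 < y → 0 ≤ (-1 : ℝ) ^ n * iteratedDeriv n f y

/-- `f` is a Bernstein function on `]0, ∞[`: it is non-negative and differentiable there, and its
derivative is completely monotone. -/
def IsBernstein (f : ℝ → ℝ) : Prop :=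
  (∀ y : ℝ, 0 < y → 0 ≤ f y) ∧ DifferentiableOn ℝ f (Set.Ioi 0) ∧ IsCompletelyMonotone (deriv f)

/-- The Laplace transform `∫₀^∞ exp (-p y) g(y) dy`. -/
noncomputable def laplaceTransform (g : ℝ → ℝ) (p : ℝ) : ℝ :=
  ∫ y in Set.Ioi (0 : ℝ), Real.exp (-(p * y)) * g y

/-- `f` is a complete Bernstein function on `]0, ∞[`: there is a Bernstein function `g` whose Laplace
transform converges at every `y > 0` and satisfies `f(y) = y² g̃(y)`. -/
def IsCompleteBernstein (f : ℝ → ℝ) : Prop :=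
  ∃ g : ℝ → ℝ, IsBernstein g ∧ ∀ y : ℝ, 0 < y →
    MeasureTheory.IntegrableOn (fun t : ℝ => Real.exp (-(y * t)) * g t) (Set.Ioi 0) ∧
      f y = y ^ 2 * laplaceTransform g y

/-- The power-law attenuation model `Q(p) = c² / [1 + a p^(α - 1)]²`, for `p > 0`. -/
noncomputable def powerLawQ (c a α p : ℝ) : ℝ :=
  c ^ 2 / (1 + a * p ^ (α - 1)) ^ 2

/-!
Both parts come from an integral representation `f p = ∫ p / (p + X) dμ` with `X > 0`. Such an `f`
is a complete Bernstein function: since `1 / (p (p + x))` is the Laplace transform of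
`t ↦ (1 - exp (-t x)) / x`, Fubini's theorem gives `f p = p ^ 2 * ĝ p` with
`g t = ∫ (1 - exp (-t X)) / X dμ`, and `g' t = ∫ exp (-t X) dμ` is completely monotone
(`isCompleteBernstein_integral_div_add`).

The representation is obtained in the logarithmic coordinate `w = log p`. Write `β = 1 - α`. Then
`1 / (1 + a p ^ (-β))` becomes `z / (z + a)` with `z = exp (β w)`, which for `0 < β < 1` is
holomorphic on the closed strip `|Im w| ≤ π`, the image of the slit plane with both sides of its cut.
Cauchy's theorem, applied to `(F w - F x) * exp x / (exp x - exp w)` on the rectangles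
`|Re w| ≤ R`, `|Im w| ≤ π`, yields (`eq_integral_im_edge`)
`F x = (1 / π) ∫ Im F (u + i π) * exp x / (exp x + exp u) du`.
The kernel has period `2 π i`, so the horizontal edges contribute only the imaginary part of `F`, and
it tends to `1` on the left and to `0` on the right, which makes the value `F x` appear; subtracting
`F x` removes the pole, so that no residue theorem is needed.

It remains to see that `Im F ≥ 0` on the upper edge. For `F = c z / (z + a)` the sign is that of
`sin (π β)`. For `F = (c z / (z + a)) ^ 2` one has `Im F = 2 c ^ 2 Re (z / (z + a)) Im (z / (z + a))`,
and the real part is non-negative as well when `β ≤ 1 / 2`. The constant cases `a = 0` and `β = 0`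
and the case `β = 1`, a single function `c p / (p + a)`, are elementary.
-/

open MeasureTheory ProbabilityTheory Filter Topology

/-! ### Laplace transforms of measures and functions of Stieltjes type -/

lemma IsCompletelyMonotone.congr {f g : ℝ → ℝ} (hf : IsCompletelyMonotone f)
    (hfg : Set.EqOn g f (Set.Ioi 0)) : IsCompletelyMonotone g := by
  refine ⟨hf.1.congr hfg, fun n y hy => ?_⟩
  rw [hfg.iteratedDeriv_of_isOpen isOpen_Ioi n hy]
  exact hf.2 n y hy

lemma IsCompleteBernstein.congr {f g : ℝ → ℝ} (hf : IsCompleteBernstein f)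
    (hfg : Set.EqOn g f (Set.Ioi 0)) : IsCompleteBernstein g := by
  obtain ⟨h, hh, hl⟩ := hf
  exact ⟨h, hh, fun y hy => ⟨(hl y hy).1, (hfg hy).trans (hl y hy).2⟩⟩

lemma isCompletelyMonotone_const {c : ℝ} (hc : 0 ≤ c) : IsCompletelyMonotone fun _ => c := by
  refine ⟨contDiffOn_const, fun n y _ => ?_⟩
  rw [iteratedDeriv_const]
  rcases n with _ | n <;> simp [hc]

/-- A non-negative constant is `p ^ 2` times the Laplace transform of the linear function `c t`. -/
lemma isCompleteBernstein_const {c : ℝ} (hc : 0 ≤ c) : IsCompleteBernstein fun _ => c := by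
  refine ⟨fun t => c * t, ⟨fun y hy => by positivity, by fun_prop, ?_⟩, fun y hy => ?_⟩
  · refine (isCompletelyMonotone_const hc).congr fun t _ => ?_
    simp
  · have h1 : IntegrableOn (fun t : ℝ => t * Real.exp (-y * t)) (Set.Ioi 0) := by
      have := integrableOn_rpow_mul_exp_neg_mul_rpow (p := 1) (s := 1) (b := y)
        (by norm_num) (by norm_num) hy
      simpa using this
    have h2 : ∫ t in Set.Ioi (0 : ℝ), t * Real.exp (-(y * t)) = 1 / y ^ 2 := by
      have := Real.integral_rpow_mul_exp_neg_mul_Ioi (a := 2) (by norm_num) hy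
      norm_num [Real.Gamma_two] at this
      simpa using this
    have h3 : ∀ t : ℝ, Real.exp (-(y * t)) * (c * t) = c * (t * Real.exp (-(y * t))) :=
      fun t => by ring
    refine ⟨?_, ?_⟩
    · simp only [h3]
      have := h1.const_mul c
      simpa [IntegrableOn] using this
    · simp only [laplaceTransform, h3]
      rw [integral_const_mul, h2]
      field_simp

section Stieltjes

variable {Ω : Type*} [MeasurableSpace Ω] {μ : Measure Ω} {X : Ω → ℝ}

lemma one_sub_exp_div_nonneg {t x : ℝ} (ht : 0 ≤ t) (hx : 0 < x) :
    0 ≤ (1 - Real.exp (-(t * x))) / x := by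
  have : Real.exp (-(t * x)) ≤ 1 := Real.exp_le_one_iff.2 (by nlinarith)
  exact div_nonneg (by linarith) hx.le

lemma one_sub_exp_div_le {t x : ℝ} (hx : 0 < x) :
    (1 - Real.exp (-(t * x))) / x ≤ (1 + t) * (1 / (1 + x)) := by
  have h1 := Real.add_one_le_exp (-(t * x))
  have h2 := Real.exp_pos (-(t * x))
  rw [mul_one_div, div_le_div_iff₀ hx (by linarith)]
  nlinarith

lemma exp_neg_mul_le {t x : ℝ} (ht : 0 < t) (hx : 0 < x) :
    Real.exp (-(t * x)) ≤ (1 + 1 / t) * (1 / (1 + x)) := by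
  have h1 := Real.add_one_le_exp (t * x)
  have hx' : 0 < t * x := by positivity
  rw [Real.exp_neg, mul_one_div, inv_le_comm₀ (Real.exp_pos _) (by positivity), inv_div]
  refine le_trans ?_ h1
  rw [div_le_iff₀ (by positivity)]
  have : (t * x + 1) * (1 + 1 / t) = t * x + 1 + x + 1 / t := by field_simp; ring
  have : 0 < 1 / t := by positivity
  nlinarith

lemma integrable_exp_neg_mul_of_integrable_one_div (hXm : Measurable X) (hX : ∀ w, 0 < X w)
    (hμ : Integrable (fun w => 1 / (1 + X w)) μ) {t : ℝ} (ht : 0 < t) :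
    Integrable (fun w => Real.exp (-(t * X w))) μ := by
  refine (hμ.const_mul (1 + 1 / t)).mono' (by fun_prop) (ae_of_all _ fun w => ?_)
  rw [Real.norm_of_nonneg (Real.exp_pos _).le]
  exact exp_neg_mul_le ht (hX w)

lemma integrable_one_sub_exp_div (hXm : Measurable X) (hX : ∀ w, 0 < X w)
    (hμ : Integrable (fun w => 1 / (1 + X w)) μ) {t : ℝ} (ht : 0 ≤ t) :
    Integrable (fun w => (1 - Real.exp (-(t * X w))) / X w) μ := by
  refine (hμ.const_mul (1 + t)).mono'
    (Measurable.aestronglyMeasurable (by fun_prop)) (ae_of_all _ fun w => ?_)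
  rw [Real.norm_of_nonneg (one_sub_exp_div_nonneg ht (hX w))]
  exact one_sub_exp_div_le (hX w)

/-- The easy half of Bernstein's theorem, read off from the derivatives of the moment generating
function of `-X`. -/
lemma isCompletelyMonotone_mgf_neg (hX : ∀ w, 0 < X w)
    (hint : ∀ t : ℝ, 0 < t → Integrable (fun w => Real.exp (-(t * X w))) μ) :
    IsCompletelyMonotone (mgf (fun w => -X w) μ) := by
  have hsub : Set.Ioi 0 ⊆ interior (integrableExpSet (fun w => -X w) μ) := by
    refine interior_maximal (fun t ht => ?_) isOpen_Ioi
    have := hint t ht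
    simpa [integrableExpSet] using this
  refine ⟨(analyticOn_mgf.mono hsub).contDiffOn (uniqueDiffOn_Ioi 0), fun n y hy => ?_⟩
  rw [iteratedDeriv_mgf (hsub hy), ← integral_const_mul]
  refine integral_nonneg fun w => ?_
  simp only [Pi.zero_apply]
  rw [← mul_assoc, ← mul_pow]
  have := hX w
  have := Real.exp_pos (y * -X w)
  have : 0 ≤ -1 * -X w := by linarith
  positivity

lemma hasDerivAt_integral_one_sub_exp_div (hXm : Measurable X) (hX : ∀ w, 0 < X w)
    (hμ : Integrable (fun w => 1 / (1 + X w)) μ) {t : ℝ} (ht : 0 < t) :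
    HasDerivAt (fun t => ∫ w, (1 - Real.exp (-(t * X w))) / X w ∂μ)
      (mgf (fun w => -X w) μ t) t := by
  have key := (hasDerivAt_integral_of_dominated_loc_of_deriv_le (μ := μ) (x₀ := t)
    (F := fun t w => (1 - Real.exp (-(t * X w))) / X w)
    (F' := fun t w => Real.exp (-(t * X w))) (s := Set.Ioi (t / 2))
    (bound := fun w => Real.exp (-(t / 2 * X w)))
    (Ioi_mem_nhds (by linarith))
    (Eventually.of_forall fun t => Measurable.aestronglyMeasurable (by fun_prop))
    (integrable_one_sub_exp_div hXm hX hμ ht.le)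
    (Measurable.aestronglyMeasurable (by fun_prop))
    (ae_of_all _ fun w s hs => ?_)
    (integrable_exp_neg_mul_of_integrable_one_div hXm hX hμ (by linarith))
    (ae_of_all _ fun w s hs => ?_)).2
  · simpa [mgf] using key
  · rw [Real.norm_of_nonneg (Real.exp_pos _).le]
    have := hX w
    have hs' : t / 2 < s := hs
    exact Real.exp_le_exp.2 (by nlinarith)
  · have h := (((((hasDerivAt_id s).mul_const (X w)).neg).exp.const_sub 1).div_const (X w))
    convert! h using 1
    have := (hX w).ne'
    simp only [id, Pi.neg_apply]
    field_simp

/-- The Laplace transform of `t ↦ (1 - exp (-t x)) / x` is `p ↦ 1 / (p (p + x))`. -/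
lemma laplace_one_sub_exp_div {p x : ℝ} (hp : 0 < p) (hx : 0 < x) :
    IntegrableOn (fun t : ℝ => Real.exp (-(p * t)) * ((1 - Real.exp (-(t * x))) / x)) (Set.Ioi 0) ∧
      ∫ t in Set.Ioi (0 : ℝ), Real.exp (-(p * t)) * ((1 - Real.exp (-(t * x))) / x) =
        1 / (p * (p + x)) := by
  have e : ∀ t : ℝ, Real.exp (-(p * t)) * ((1 - Real.exp (-(t * x))) / x) =
      (1 / x) * (Real.exp (-p * t) - Real.exp (-(p + x) * t)) := fun t => by
    have : Real.exp (-(p + x) * t) = Real.exp (-(p * t)) * Real.exp (-(t * x)) := by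
      rw [← Real.exp_add]; congr 1; ring
    rw [this, neg_mul]; ring
  have h1 := integrableOn_exp_mul_Ioi (a := -p) (by linarith) 0
  have h2 := integrableOn_exp_mul_Ioi (a := -(p + x)) (by linarith) 0
  simp only [e]
  refine ⟨(h1.sub h2).const_mul _, ?_⟩
  rw [integral_const_mul, integral_sub h1 h2, integral_exp_mul_Ioi (by linarith),
    integral_exp_mul_Ioi (by linarith)]
  simp only [mul_zero, Real.exp_zero, neg_div_neg_eq]
  field_simp
  ring

/-- A superposition of the functions `p ↦ p / (p + x)`, `x > 0`, is a complete Bernstein function: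
it is `p ^ 2` times the Laplace transform of `t ↦ ∫ (1 - exp (-t x)) / x`, whose derivative
`t ↦ ∫ exp (-t x)` is completely monotone. -/
theorem isCompleteBernstein_integral_div_add [SFinite μ] (hXm : Measurable X)
    (hX : ∀ w, 0 < X w) (hμ : Integrable (fun w => 1 / (1 + X w)) μ) :
    IsCompleteBernstein fun p => ∫ w, p / (p + X w) ∂μ := by
  have hder : ∀ t : ℝ, 0 < t → _ := fun t ht =>
    hasDerivAt_integral_one_sub_exp_div hXm hX hμ ht
  refine ⟨fun t => ∫ w, (1 - Real.exp (-(t * X w))) / X w ∂μ, ⟨fun t ht => ?_, fun t ht => ?_, ?_⟩,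
    fun p hp => ?_⟩
  · exact integral_nonneg fun w => one_sub_exp_div_nonneg ht.le (hX w)
  · exact (hder t ht).differentiableAt.differentiableWithinAt
  · exact (isCompletelyMonotone_mgf_neg hX fun t ht =>
      integrable_exp_neg_mul_of_integrable_one_div hXm hX hμ ht).congr
        fun t ht => (hder t ht).deriv
  · have hint : Integrable (Function.uncurry fun (t : ℝ) (w : Ω) =>
        Real.exp (-(p * t)) * ((1 - Real.exp (-(t * X w))) / X w))
        ((volume.restrict (Set.Ioi 0)).prod μ) := by
      rw [integrable_prod_iff' (Measurable.aestronglyMeasurable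
        (by unfold Function.uncurry; fun_prop))]
      refine ⟨ae_of_all _ fun w => (laplace_one_sub_exp_div hp (hX w)).1, ?_⟩
      have e : ∀ w, ∫ t in Set.Ioi (0 : ℝ), ‖Function.uncurry (fun (t : ℝ) (w : Ω) =>
          Real.exp (-(p * t)) * ((1 - Real.exp (-(t * X w))) / X w)) (t, w)‖ =
            1 / (p * (p + X w)) := fun w => by
        rw [← (laplace_one_sub_exp_div hp (hX w)).2]
        refine setIntegral_congr_fun measurableSet_Ioi fun t ht => ?_
        exact Real.norm_of_nonneg (mul_nonneg (Real.exp_pos _).le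
          (one_sub_exp_div_nonneg (le_of_lt ht) (hX w)))
      simp only [e]
      refine (hμ.const_mul ((1 + 1 / p) / p)).mono'
        (Measurable.aestronglyMeasurable (by fun_prop)) (ae_of_all _ fun w => ?_)
      have hw := hX w
      rw [Real.norm_of_nonneg (by positivity), div_mul_div_comm, mul_one,
        div_le_div_iff₀ (by positivity) (by positivity)]
      have : (1 + 1 / p) * (p * (p + X w)) = (p + 1) * (p + X w) := by field_simp
      rw [this]
      nlinarith [mul_pos hp hw]
    have e2 : ∀ t : ℝ, Real.exp (-(p * t)) * ∫ w, (1 - Real.exp (-(t * X w))) / X w ∂μ =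
        ∫ w, Real.exp (-(p * t)) * ((1 - Real.exp (-(t * X w))) / X w) ∂μ :=
      fun t => (integral_const_mul _ _).symm
    simp only [laplaceTransform, e2]
    refine ⟨hint.integral_prod_left, ?_⟩
    rw [integral_integral_swap hint, ← integral_const_mul]
    refine integral_congr_ae (ae_of_all _ fun w => ?_)
    have := hX w
    simp only [(laplace_one_sub_exp_div hp (hX w)).2]
    field_simp

end Stieltjes

/-! ### A Cauchy type representation in the strip `|Im w| ≤ π` -/

section Strip

open Complex

lemma integrable_exp_mul_div_add_exp {β y : ℝ} (hβ : 0 < β) (hβ1 : β < 1) (hy : 0 < y) :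
    Integrable fun u : ℝ => Real.exp (β * u) * (1 / (y + Real.exp u)) := by
  rw [← integrableOn_univ, ← Set.Iic_union_Ioi (a := (0 : ℝ))]
  have hm : Measurable fun u : ℝ => Real.exp (β * u) * (1 / (y + Real.exp u)) := by fun_prop
  have hn : ∀ u : ℝ, ‖Real.exp (β * u) * (1 / (y + Real.exp u))‖ =
      Real.exp (β * u) * (1 / (y + Real.exp u)) := fun u =>
    Real.norm_of_nonneg (by positivity)
  refine IntegrableOn.union ?_ ?_
  · refine ((integrableOn_exp_mul_Iic hβ 0).mul_const (1 / y)).mono' hm.aestronglyMeasurable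
      (ae_of_all _ fun u => ?_)
    rw [hn]
    gcongr
    linarith [Real.exp_pos u]
  · refine (integrableOn_exp_mul_Ioi (a := β - 1) (by linarith) 0).mono' hm.aestronglyMeasurable
      (ae_of_all _ fun u => ?_)
    rw [hn, sub_mul, one_mul, Real.exp_sub, mul_one_div]
    gcongr
    linarith

/-- In the strip `|Im w| ≤ π`, the function `exp` takes each positive real value only once. -/
lemma eq_of_exp_eq_exp_ofReal {x : ℝ} {w : ℂ} (hw : |w.im| ≤ Real.pi) (h : exp w = exp x) :
    w = x := by
  obtain ⟨n, hn⟩ := Complex.exp_eq_exp_iff_exists_int.1 h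
  have him := congrArg Complex.im hn
  simp only [add_im, ofReal_im, mul_im, intCast_re, intCast_im, mul_re, I_re, I_im, re_ofNat,
    im_ofNat, ofReal_re] at him
  have hpi := Real.pi_pos
  have hn0 : |(n : ℝ)| < 1 := by
    by_contra! hcon
    have : |w.im| = |(n : ℝ)| * (2 * Real.pi) := by
      have : w.im = n * (2 * Real.pi) := by rw [him]; ring
      rw [this, abs_mul, abs_of_pos (by linarith : 0 < 2 * Real.pi)]
    nlinarith
  have : n = 0 := by
    rw [← Int.abs_lt_one_iff]
    exact_mod_cast hn0
  simpa [this] using hn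

lemma dslope_exp_ne_zero {x : ℝ} {w : ℂ} (hw : |w.im| ≤ Real.pi) : dslope exp (x : ℂ) w ≠ 0 := by
  rcases eq_or_ne w x with rfl | hne
  · simp
  · rw [dslope_of_ne _ hne, slope_def_field]
    refine div_ne_zero (fun h => hne ?_) (sub_ne_zero.2 hne)
    exact eq_of_exp_eq_exp_ofReal hw (sub_eq_zero.1 h)

/-- The product of `F w - F x` and `exp x / (exp x - exp w)`, with the removable singularity at
`w = x` filled in. -/
noncomputable def stripKernel (F : ℂ → ℂ) (x : ℝ) (w : ℂ) : ℂ :=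
  -exp x * dslope F x w / dslope exp (x : ℂ) w

variable {F : ℂ → ℂ} {x : ℝ} {w : ℂ}

lemma stripKernel_of_ne (hw : w ≠ x) :
    stripKernel F x w = (F w - F x) * (exp x / (exp x - exp w)) := by
  rw [stripKernel, dslope_of_ne _ hw, dslope_of_ne _ hw, slope_def_field, slope_def_field]
  have h1 : w - x ≠ 0 := sub_ne_zero.2 hw
  rw [← neg_sub (exp w) (exp (x : ℂ)), mul_div_assoc, div_div_div_cancel_right₀ h1, div_neg]
  ring

lemma continuousAt_stripKernel (hF : DifferentiableAt ℂ F w) (hFx : DifferentiableAt ℂ F x)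
    (hw : |w.im| ≤ Real.pi) : ContinuousAt (stripKernel F x) w := by
  have key : ∀ G : ℂ → ℂ, DifferentiableAt ℂ G w → DifferentiableAt ℂ G x →
      ContinuousAt (dslope G (x : ℂ)) w := fun G h1 h2 => by
    rcases eq_or_ne w x with rfl | hne
    · exact continuousAt_dslope_same.2 h2
    · exact (continuousAt_dslope_of_ne hne).2 h1.continuousAt
  exact ((key F hF hFx).const_mul _).div
    (key exp differentiableAt_exp differentiableAt_exp) (dslope_exp_ne_zero hw)

lemma differentiableAt_stripKernel (hF : DifferentiableAt ℂ F w) (hne : w ≠ x)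
    (hw : |w.im| ≤ Real.pi) : DifferentiableAt ℂ (stripKernel F x) w :=
  (((differentiableAt_dslope_of_ne hne).2 hF).const_mul _).div
    ((differentiableAt_dslope_of_ne hne).2 differentiableAt_exp) (dslope_exp_ne_zero hw)

lemma exp_ofReal_add_pi_mul_I (u : ℝ) : exp (u + Real.pi * I) = -(Real.exp u : ℂ) := by
  rw [exp_add, exp_pi_mul_I, ofReal_exp]; ring

lemma exp_ofReal_sub_pi_mul_I (u : ℝ) : exp (u - Real.pi * I) = -(Real.exp u : ℂ) := by
  rw [exp_sub, exp_pi_mul_I, ofReal_exp, div_neg, div_one]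

/-- On the two edges `Im w = ± π` the kernel `exp x / (exp x - exp w)` takes the same real values,
so that only the imaginary part of `F` survives in the difference. -/
lemma stripKernel_edge_sub (hconj : ∀ w, F ((starRingEnd ℂ) w) = (starRingEnd ℂ) (F w))
    (u : ℝ) :
    stripKernel F x (u - Real.pi * I) - stripKernel F x (u + Real.pi * I) =
      -2 * I * ((F (u + Real.pi * I)).im * (Real.exp x / (Real.exp x + Real.exp u)) : ℝ) := by
  have hpi := Real.pi_pos.ne'
  have h1 : (u - Real.pi * I : ℂ) ≠ x := fun h => hpi (by simpa using congrArg Complex.im h)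
  have h2 : (u + Real.pi * I : ℂ) ≠ x := fun h => hpi (by simpa using congrArg Complex.im h)
  have h3 : F (u - Real.pi * I) = (starRingEnd ℂ) (F (u + Real.pi * I)) := by
    rw [← hconj]; simp [sub_eq_add_neg]
  rw [stripKernel_of_ne h1, stripKernel_of_ne h2, exp_ofReal_add_pi_mul_I,
    exp_ofReal_sub_pi_mul_I, h3]
  have h4 := Complex.sub_conj (F (u + Real.pi * I))
  push_cast
  rw [sub_neg_eq_add, ← sub_mul, sub_sub_sub_cancel_right, ← neg_sub, h4]
  push_cast
  ring

/-- Cauchy's theorem for `stripKernel F x` on the rectangle `|Re w| ≤ R`, `|Im w| ≤ π`. -/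
lemma integral_vertical_sub_eq
    (hd : ∀ w : ℂ, |w.im| ≤ Real.pi → DifferentiableAt ℂ F w)
    (hconj : ∀ w, F ((starRingEnd ℂ) w) = (starRingEnd ℂ) (F w)) (x R : ℝ) :
    (∫ y in (-Real.pi)..Real.pi, stripKernel F x (R + y * I)) -
        ∫ y in (-Real.pi)..Real.pi, stripKernel F x ((-R : ℝ) + y * I) =
      2 * ((∫ u in (-R)..R, (F (u + Real.pi * I)).im *
        (Real.exp x / (Real.exp x + Real.exp u)) : ℝ) : ℂ) := by
  have hpi := Real.pi_pos
  have hdx : DifferentiableAt ℂ F x := hd x (by simp [hpi.le])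
  have hc : ∀ w : ℂ, |w.im| ≤ Real.pi → ContinuousAt (stripKernel F x) w := fun w hw =>
    continuousAt_stripKernel (hd w hw) hdx hw
  have hrect := integral_boundary_rect_eq_zero_of_differentiable_on_off_countable
    (stripKernel F x) (-R - Real.pi * I) (R + Real.pi * I) {(x : ℂ)} (Set.countable_singleton _)
    (fun w hw => (hc w ?_).continuousWithinAt) (fun w hw => ?_)
  · have hb : Continuous fun u : ℝ => stripKernel F x (u - Real.pi * I) :=
      continuous_iff_continuousAt.2 fun u =>
        ContinuousAt.comp (f := fun u : ℝ => (u - Real.pi * I : ℂ))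
          (hc _ (by simp [abs_of_pos hpi])) (by fun_prop)
    have ht : Continuous fun u : ℝ => stripKernel F x (u + Real.pi * I) :=
      continuous_iff_continuousAt.2 fun u =>
        ContinuousAt.comp (f := fun u : ℝ => (u + Real.pi * I : ℂ))
          (hc _ (by simp [abs_of_pos hpi])) (by fun_prop)
    have e1 : (∫ u in (-R)..R, stripKernel F x (u - Real.pi * I)) -
        ∫ u in (-R)..R, stripKernel F x (u + Real.pi * I) =
        -2 * I * ((∫ u in (-R)..R, (F (u + Real.pi * I)).im *
        (Real.exp x / (Real.exp x + Real.exp u)) : ℝ) : ℂ) := by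
      rw [← intervalIntegral.integral_sub (hb.intervalIntegrable _ _) (ht.intervalIntegrable _ _)]
      simp only [stripKernel_edge_sub hconj]
      rw [intervalIntegral.integral_const_mul, intervalIntegral.integral_ofReal]
    simp only [sub_re, neg_re, ofReal_re, mul_re, I_re, I_im, ofReal_im, sub_im, neg_im, mul_im,
      add_re, add_im, smul_eq_mul, mul_zero, mul_one, sub_zero, add_zero, zero_add,
      neg_zero, zero_sub, ofReal_neg, neg_mul] at hrect
    simp only [← sub_eq_add_neg] at hrect
    rw [e1] at hrect
    push_cast at hrect ⊢
    have hI : (I : ℂ) ≠ 0 := I_ne_zero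
    refine mul_left_cancel₀ hI ?_
    linear_combination hrect
  · have := hw.2
    simp only [sub_im, neg_im, mul_im, add_im, ofReal_im, ofReal_re, I_re, I_im] at this
    rw [Set.mem_preimage, Set.uIcc_of_le (by simp; linarith)] at this
    rw [abs_le]
    constructor <;> [have := this.1; have := this.2] <;> simpa using this
  · refine differentiableAt_stripKernel (hd w ?_) hw.2 ?_ <;>
    · have := hw.1.2
      simp only [sub_im, neg_im, mul_im, add_im, ofReal_im, ofReal_re, I_re, I_im, mul_zero,
        mul_one, neg_zero, add_zero, zero_sub, zero_add,
        min_eq_left (by linarith : -Real.pi ≤ Real.pi),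
        max_eq_right (by linarith : -Real.pi ≤ Real.pi)] at this
      rw [abs_le]
      exact ⟨this.1.le, this.2.le⟩

variable {C β : ℝ}

lemma norm_stripKernel_right_le (hb : ‖F w‖ ≤ C * Real.exp (β * w.re)) (hw : x + 1 ≤ w.re) :
    ‖stripKernel F x w‖ ≤
      (C * Real.exp (β * w.re) + ‖F x‖) * (2 * Real.exp x * Real.exp (-w.re)) := by
  have hne : w ≠ x := fun h => by simp [h] at hw; linarith
  have h2 : Real.exp w.re / 2 ≤ ‖exp x - exp w‖ := by
    have h3 := norm_sub_norm_le (exp w) (exp x)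
    rw [norm_sub_rev, norm_exp, norm_exp, ofReal_re] at h3
    have h4 : Real.exp (x + 1) ≤ Real.exp w.re := Real.exp_le_exp.2 hw
    rw [Real.exp_add] at h4
    have h5 := Real.add_one_le_exp (1 : ℝ)
    nlinarith [Real.exp_pos x]
  rw [stripKernel_of_ne hne, norm_mul, norm_div, norm_exp, ofReal_re]
  refine mul_le_mul ((norm_sub_le _ _).trans (by gcongr)) ?_ (by positivity)
    (add_nonneg ((norm_nonneg _).trans hb) (norm_nonneg _))
  calc Real.exp x / ‖exp x - exp w‖ ≤ Real.exp x / (Real.exp w.re / 2) := by gcongr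
    _ = _ := by rw [Real.exp_neg]; field_simp

lemma norm_stripKernel_left_le (hb : ‖F w‖ ≤ C * Real.exp (β * w.re)) (hw : w.re ≤ x - 1) :
    ‖stripKernel F x w + F x‖ ≤
      C * Real.exp (β * w.re) * 2 + ‖F x‖ * (2 * Real.exp (-x) * Real.exp w.re) := by
  have hne : w ≠ x := fun h => by simp [h] at hw; linarith
  have h2 : Real.exp x / 2 ≤ ‖exp x - exp w‖ := by
    have h3 := norm_sub_norm_le (exp x) (exp w)
    rw [norm_exp, norm_exp, ofReal_re] at h3
    have h4 : Real.exp (w.re + 1) ≤ Real.exp x := Real.exp_le_exp.2 (by linarith)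
    rw [Real.exp_add] at h4
    have h5 := Real.add_one_le_exp (1 : ℝ)
    nlinarith [Real.exp_pos w.re]
  have h6 : exp x - exp w ≠ 0 := norm_pos_iff.1 ((half_pos (Real.exp_pos x)).trans_le h2)
  have h7 : stripKernel F x w + F x =
      F w * (exp x / (exp x - exp w)) + F x * (-exp w / (exp x - exp w)) := by
    rw [stripKernel_of_ne hne]
    field_simp
    ring
  rw [h7]
  refine (norm_add_le _ _).trans (add_le_add ?_ ?_)
  · rw [norm_mul, norm_div, norm_exp, ofReal_re]
    refine mul_le_mul hb ?_ (by positivity) ((norm_nonneg _).trans hb)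
    rw [div_le_iff₀ (norm_pos_iff.2 h6)]
    linarith
  · rw [norm_mul, norm_div, norm_neg, norm_exp]
    gcongr
    calc Real.exp w.re / ‖exp x - exp w‖ ≤ Real.exp w.re / (Real.exp x / 2) := by gcongr
      _ = _ := by rw [Real.exp_neg]; field_simp

lemma tendsto_exp_neg_mul_atTop {r : ℝ} (hr : 0 < r) :
    Tendsto (fun R : ℝ => Real.exp (-(r * R))) atTop (𝓝 0) :=
  Real.tendsto_exp_neg_atTop_nhds_zero.comp (tendsto_id.const_mul_atTop hr)

lemma tendsto_integral_right (hβ1 : β < 1)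
    (hb : ∀ w : ℂ, |w.im| ≤ Real.pi → ‖F w‖ ≤ C * Real.exp (β * w.re)) :
    Tendsto (fun R : ℝ => ∫ y in (-Real.pi)..Real.pi, stripKernel F x (R + y * I))
      atTop (𝓝 0) := by
  have hpi := Real.pi_pos
  refine squeeze_zero_norm' (a := fun R => (C * Real.exp (-((1 - β) * R)) +
    ‖F x‖ * Real.exp (-(1 * R))) * (2 * Real.exp x) * |Real.pi - -Real.pi|) ?_ ?_
  · filter_upwards [eventually_ge_atTop (x + 1)] with R hR
    refine intervalIntegral.norm_integral_le_of_norm_le_const fun y hy => ?_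
    rw [Set.uIoc_of_le (by linarith)] at hy
    have him : |(R + y * I : ℂ).im| ≤ Real.pi := by
      simpa using abs_le.2 ⟨hy.1.le, hy.2⟩
    refine (norm_stripKernel_right_le (hb _ him) (by simpa using hR)).trans (le_of_eq ?_)
    have : Real.exp (-((1 - β) * R)) = Real.exp (β * R) * Real.exp (-R) := by
      rw [← Real.exp_add]; congr 1; ring
    rw [this]
    simp
    ring
  · have h1 := (tendsto_exp_neg_mul_atTop (r := 1 - β) (by linarith)).const_mul C
    have h2 := (tendsto_exp_neg_mul_atTop (r := 1) one_pos).const_mul ‖F x‖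
    simpa using ((h1.add h2).mul_const (2 * Real.exp x)).mul_const |Real.pi - -Real.pi|

lemma tendsto_integral_left (hβ : 0 < β)
    (hd : ∀ w : ℂ, |w.im| ≤ Real.pi → DifferentiableAt ℂ F w)
    (hb : ∀ w : ℂ, |w.im| ≤ Real.pi → ‖F w‖ ≤ C * Real.exp (β * w.re)) :
    Tendsto (fun R : ℝ => ∫ y in (-Real.pi)..Real.pi, stripKernel F x ((-R : ℝ) + y * I))
      atTop (𝓝 (-(2 * Real.pi * F x))) := by
  have hpi := Real.pi_pos
  rw [tendsto_iff_norm_sub_tendsto_zero]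
  refine squeeze_zero' (Eventually.of_forall fun _ => norm_nonneg _)
    (g := fun R => (C * Real.exp (-(β * R)) * 2 +
      ‖F x‖ * (2 * Real.exp (-x) * Real.exp (-(1 * R)))) * |Real.pi - -Real.pi|) ?_ ?_
  · filter_upwards [eventually_ge_atTop (1 - x)] with R hR
    have him : ∀ y ∈ Set.Icc (-Real.pi) Real.pi, |((-R : ℝ) + y * I : ℂ).im| ≤ Real.pi :=
      fun y hy => by simpa using abs_le.2 ⟨hy.1, hy.2⟩
    have hint : IntervalIntegrable (fun y : ℝ => stripKernel F x ((-R : ℝ) + y * I)) volume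
        (-Real.pi) Real.pi := by
      refine ContinuousOn.intervalIntegrable fun y hy => ContinuousAt.continuousWithinAt ?_
      rw [Set.uIcc_of_le (by linarith)] at hy
      exact ContinuousAt.comp (f := fun y : ℝ => ((-R : ℝ) + y * I : ℂ))
        (continuousAt_stripKernel (hd _ (him y hy)) (hd x (by simp [hpi.le])) (him y hy))
        (by fun_prop)
    have e : (∫ y in (-Real.pi)..Real.pi, stripKernel F x ((-R : ℝ) + y * I)) -
        -(2 * Real.pi * F x) =
        ∫ y in (-Real.pi)..Real.pi, (stripKernel F x ((-R : ℝ) + y * I) + F x) := by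
      rw [intervalIntegral.integral_add hint intervalIntegrable_const,
        intervalIntegral.integral_const]
      rw [real_smul]
      push_cast
      ring
    rw [e]
    refine intervalIntegral.norm_integral_le_of_norm_le_const fun y hy => ?_
    rw [Set.uIoc_of_le (by linarith)] at hy
    refine (norm_stripKernel_left_le (hb _ (him y ⟨hy.1.le, hy.2⟩))
      (by simp; linarith)).trans (le_of_eq ?_)
    simp
  · have h1 := ((tendsto_exp_neg_mul_atTop hβ).const_mul C).mul_const 2
    have h2 := ((tendsto_exp_neg_mul_atTop (r := 1) one_pos).const_mul
      (2 * Real.exp (-x))).const_mul ‖F x‖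
    simpa using (h1.add h2).mul_const |Real.pi - -Real.pi|

lemma continuous_im_edge (hd : ∀ w : ℂ, |w.im| ≤ Real.pi → DifferentiableAt ℂ F w) :
    Continuous fun u : ℝ => (F (u + Real.pi * I)).im :=
  continuous_im.comp <| continuous_iff_continuousAt.2 fun u =>
    ContinuousAt.comp (f := fun u : ℝ => (u + Real.pi * I : ℂ))
      (hd _ (by simp [abs_of_pos Real.pi_pos])).continuousAt (by fun_prop)

lemma integrable_im_edge_mul (hβ : 0 < β) (hβ1 : β < 1)
    (hd : ∀ w : ℂ, |w.im| ≤ Real.pi → DifferentiableAt ℂ F w)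
    (hb : ∀ w : ℂ, |w.im| ≤ Real.pi → ‖F w‖ ≤ C * Real.exp (β * w.re)) {y : ℝ} (hy : 0 < y) :
    Integrable fun u : ℝ => (F (u + Real.pi * I)).im * (1 / (y + Real.exp u)) := by
  have hc := (continuous_im_edge hd).measurable
  refine ((integrable_exp_mul_div_add_exp hβ hβ1 hy).const_mul C).mono'
    (Measurable.aestronglyMeasurable (by fun_prop)) (ae_of_all _ fun u => ?_)
  have h1 : 0 < 1 / (y + Real.exp u) := by positivity
  rw [norm_mul, Real.norm_of_nonneg h1.le, ← mul_assoc]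
  gcongr
  refine (abs_im_le_norm _).trans ((hb _ (by simp [abs_of_pos Real.pi_pos])).trans (le_of_eq ?_))
  simp

/-- A function that is holomorphic in the strip `|Im w| ≤ π`, real on the real axis, and
`O(exp (β Re w))` with `0 < β < 1`, is recovered from its imaginary part on the upper edge: the
kernel `exp x / (exp x - exp w)` has period `2 π i`, tends to `1` on the left and to `0` on the
right. -/
theorem eq_integral_im_edge (hβ : 0 < β) (hβ1 : β < 1)
    (hd : ∀ w : ℂ, |w.im| ≤ Real.pi → DifferentiableAt ℂ F w)
    (hb : ∀ w : ℂ, |w.im| ≤ Real.pi → ‖F w‖ ≤ C * Real.exp (β * w.re))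
    (hconj : ∀ w, F ((starRingEnd ℂ) w) = (starRingEnd ℂ) (F w)) (x : ℝ) :
    F x = ((∫ u : ℝ, (F (u + Real.pi * I)).im / Real.pi *
      (Real.exp x / (Real.exp x + Real.exp u)) : ℝ) : ℂ) := by
  have hpi := Real.pi_pos.ne'
  have hint : Integrable fun u : ℝ => (F (u + Real.pi * I)).im *
      (Real.exp x / (Real.exp x + Real.exp u)) := by
    refine ((integrable_im_edge_mul hβ hβ1 hd hb (Real.exp_pos x)).const_mul
      (Real.exp x)).congr (ae_of_all _ fun u => ?_)
    simp only
    ring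
  have h1 := (tendsto_integral_right (x := x) hβ1 hb).sub (tendsto_integral_left (x := x) hβ hd hb)
  simp only [integral_vertical_sub_eq hd hconj] at h1
  have h2 := (continuous_ofReal.tendsto _).comp
    (intervalIntegral_tendsto_integral hint tendsto_neg_atTop_atBot tendsto_id)
  have h3 := tendsto_nhds_unique h1 (h2.const_mul 2)
  have h4 : ∀ u : ℝ, (F (u + Real.pi * I)).im / Real.pi *
      (Real.exp x / (Real.exp x + Real.exp u)) = Real.pi⁻¹ * ((F (u + Real.pi * I)).im *
      (Real.exp x / (Real.exp x + Real.exp u))) := fun u => by ring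
  simp only [h4]
  rw [integral_const_mul]
  have hpi' : (Real.pi : ℂ) ≠ 0 := by exact_mod_cast hpi
  push_cast
  rw [eq_inv_mul_iff_mul_eq₀ hpi']
  linear_combination h3 / 2

/-- In logarithmic coordinates: if `f = F ∘ log` where `F` is holomorphic in the strip
`|Im w| ≤ π` with moderate growth and non-negative imaginary part on the upper edge, then `f` is a
superposition of the functions `p ↦ p / (p + exp u)` with density `Im F (u + i π) / π`. -/
theorem isCompleteBernstein_of_strip {f : ℝ → ℝ} (hβ : 0 < β) (hβ1 : β < 1)
    (hd : ∀ w : ℂ, |w.im| ≤ Real.pi → DifferentiableAt ℂ F w)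
    (hb : ∀ w : ℂ, |w.im| ≤ Real.pi → ‖F w‖ ≤ C * Real.exp (β * w.re))
    (hconj : ∀ w, F ((starRingEnd ℂ) w) = (starRingEnd ℂ) (F w))
    (hpos : ∀ u : ℝ, 0 ≤ (F (u + Real.pi * I)).im)
    (hf : ∀ p : ℝ, 0 < p → (f p : ℂ) = F (Real.log p)) : IsCompleteBernstein f := by
  have hpi := Real.pi_pos
  have hm : Measurable fun u : ℝ => ((F (u + Real.pi * I)).im / Real.pi).toNNReal :=
    ((continuous_im_edge hd).measurable.div_const _).real_toNNReal
  have hρ : ∀ u : ℝ, (((F (u + Real.pi * I)).im / Real.pi).toNNReal : ℝ) =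
      (F (u + Real.pi * I)).im / Real.pi := fun u =>
    Real.coe_toNNReal _ (div_nonneg (hpos u) hpi.le)
  refine (isCompleteBernstein_integral_div_add (X := Real.exp)
    (μ := volume.withDensity fun u : ℝ => (((F (u + Real.pi * I)).im / Real.pi).toNNReal : ENNReal))
    (by fun_prop) Real.exp_pos ?_).congr fun p hp => ?_
  · rw [integrable_withDensity_iff_integrable_coe_smul hm]
    refine ((integrable_im_edge_mul hβ hβ1 hd hb one_pos).div_const Real.pi).congr
      (ae_of_all _ fun u => ?_)
    simp only [hρ, smul_eq_mul]
    ring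
  · have h := eq_integral_im_edge hβ hβ1 hd hb hconj (Real.log p)
    rw [← hf p hp, Real.exp_log hp] at h
    simp only
    rw [integral_withDensity_eq_integral_smul hm, Complex.ofReal_injective h]
    simp only [NNReal.smul_def, hρ, smul_eq_mul]

end Strip

/-! ### The power-law quotient in the strip -/

section PowerQuotient

open Complex

/-- The function `p ^ β / (p ^ β + a)` in the logarithmic coordinate `w = log p`. -/
noncomputable def powerQuotient (a β : ℝ) (w : ℂ) : ℂ :=
  exp (β * w) / (exp (β * w) + a)

variable {a β : ℝ} {w : ℂ}

lemma sin_pi_mul_pos (hβ : 0 < β) (hβ1 : β < 1) : 0 < Real.sin (Real.pi * β) :=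
  Real.sin_pos_of_pos_of_lt_pi (by positivity) (by nlinarith [Real.pi_pos])

/-- In the strip the argument of `z = exp (β w)` is at most `π β < π` in modulus, so that `z` stays
away from `-a`: the distance from `-a` to this sector is at least `a sin (π β)`. -/
lemma mul_sin_le_norm_exp_add (ha : 0 < a) (hβ : 0 < β) (hβ1 : β < 1) (hw : |w.im| ≤ Real.pi) :
    a * Real.sin (Real.pi * β) ≤ ‖exp (β * w) + a‖ := by
  have hpi := Real.pi_pos
  have hs := sin_pi_mul_pos hβ hβ1
  have hcos : Real.cos (Real.pi * β) ≤ Real.cos (β * w.im) := by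
    rw [← Real.cos_abs (β * w.im), abs_mul, abs_of_pos hβ, mul_comm Real.pi]
    exact Real.cos_le_cos_of_nonneg_of_le_pi (by positivity) (by nlinarith) (by gcongr)
  rw [← sq_le_sq₀ (by positivity) (norm_nonneg _), Complex.sq_norm, normSq_apply]
  simp only [add_re, add_im, exp_re, exp_im, ofReal_re, ofReal_im, re_ofReal_mul, im_ofReal_mul]
  have hr := Real.exp_pos (β * w.re)
  have h1 := Real.sin_sq_add_cos_sq (β * w.im)
  have h2 := Real.sin_sq_add_cos_sq (Real.pi * β)
  have h3 := mul_le_mul_of_nonneg_left hcos (mul_pos hr ha).le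
  have h4 := sq_nonneg (Real.exp (β * w.re) + a * Real.cos (Real.pi * β))
  have e1 : (Real.exp (β * w.re) * Real.cos (β * w.im) + a) *
      (Real.exp (β * w.re) * Real.cos (β * w.im) + a) +
      (Real.exp (β * w.re) * Real.sin (β * w.im) + 0) *
        (Real.exp (β * w.re) * Real.sin (β * w.im) + 0) =
      Real.exp (β * w.re) ^ 2 + 2 * (Real.exp (β * w.re) * a * Real.cos (β * w.im)) + a ^ 2 := by
    linear_combination Real.exp (β * w.re) ^ 2 * h1
  have e2 : (a * Real.sin (Real.pi * β)) ^ 2 = a ^ 2 - (a * Real.cos (Real.pi * β)) ^ 2 := by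
    linear_combination a ^ 2 * h2
  rw [e1, e2]
  nlinarith

lemma exp_add_ne_zero (ha : 0 < a) (hβ : 0 < β) (hβ1 : β < 1) (hw : |w.im| ≤ Real.pi) :
    exp (β * w) + a ≠ 0 :=
  norm_pos_iff.1 ((mul_pos ha (sin_pi_mul_pos hβ hβ1)).trans_le
    (mul_sin_le_norm_exp_add ha hβ hβ1 hw))

lemma differentiableAt_powerQuotient (ha : 0 < a) (hβ : 0 < β) (hβ1 : β < 1)
    (hw : |w.im| ≤ Real.pi) : DifferentiableAt ℂ (powerQuotient a β) w :=
  DifferentiableAt.div (by fun_prop) (by fun_prop) (exp_add_ne_zero ha hβ hβ1 hw)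

lemma norm_powerQuotient_le (ha : 0 < a) (hβ : 0 < β) (hβ1 : β < 1) (hw : |w.im| ≤ Real.pi) :
    ‖powerQuotient a β w‖ ≤ 1 / (a * Real.sin (Real.pi * β)) * Real.exp (β * w.re) := by
  have h := mul_sin_le_norm_exp_add ha hβ hβ1 hw
  have h0 := mul_pos ha (sin_pi_mul_pos hβ hβ1)
  rw [powerQuotient, norm_div, norm_exp, re_ofReal_mul, one_div_mul_eq_div]
  gcongr

lemma norm_powerQuotient_le_const (ha : 0 < a) (hβ : 0 < β) (hβ1 : β < 1)
    (hw : |w.im| ≤ Real.pi) :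
    ‖powerQuotient a β w‖ ≤ 1 + 1 / Real.sin (Real.pi * β) := by
  have h := mul_sin_le_norm_exp_add ha hβ hβ1 hw
  have hs := sin_pi_mul_pos hβ hβ1
  have hz := norm_pos_iff.2 (exp_add_ne_zero ha hβ hβ1 hw)
  have h1 : ‖exp (β * w)‖ ≤ ‖exp (β * w) + a‖ + a := by
    have := norm_sub_le (exp (β * w) + a) (a : ℂ)
    rwa [add_sub_cancel_right, norm_real, Real.norm_of_nonneg ha.le] at this
  rw [powerQuotient, norm_div, div_le_iff₀ hz, add_mul, one_mul]
  refine h1.trans (add_le_add le_rfl ?_)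
  rwa [one_div_mul_eq_div, le_div_iff₀ hs]

lemma powerQuotient_conj (a β : ℝ) (w : ℂ) :
    powerQuotient a β ((starRingEnd ℂ) w) = (starRingEnd ℂ) (powerQuotient a β w) := by
  simp [powerQuotient, ← exp_conj]

lemma powerQuotient_re_im (a β u : ℝ) :
    (powerQuotient a β (u + Real.pi * I)).re = (Real.exp (β * u) ^ 2 +
        a * Real.exp (β * u) * Real.cos (Real.pi * β)) /
          normSq (exp (β * (u + Real.pi * I)) + a) ∧
      (powerQuotient a β (u + Real.pi * I)).im =
        a * Real.exp (β * u) * Real.sin (Real.pi * β) /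
          normSq (exp (β * (u + Real.pi * I)) + a) := by
  have h1 := Real.sin_sq_add_cos_sq (β * Real.pi)
  simp only [powerQuotient, div_re, div_im, ← add_div, ← sub_div, add_re, add_im, exp_re, exp_im,
    ofReal_re, ofReal_im, re_ofReal_mul, im_ofReal_mul, I_re, I_im, mul_zero, mul_one, add_zero,
    zero_add, mul_comm Real.pi β]
  constructor
  · congr 1
    linear_combination Real.exp (β * u) ^ 2 * h1
  · congr 1
    ring

lemma powerQuotient_im_nonneg (ha : 0 < a) (hβ : 0 < β) (hβ1 : β < 1) (u : ℝ) :
    0 ≤ (powerQuotient a β (u + Real.pi * I)).im := by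
  rw [(powerQuotient_re_im a β u).2]
  have := sin_pi_mul_pos hβ hβ1
  exact div_nonneg (by positivity) (normSq_nonneg _)

lemma powerQuotient_re_nonneg (ha : 0 < a) (hβ : 0 < β) (hβ1 : β ≤ 1 / 2) (u : ℝ) :
    0 ≤ (powerQuotient a β (u + Real.pi * I)).re := by
  rw [(powerQuotient_re_im a β u).1]
  have hpi := Real.pi_pos
  have : 0 ≤ Real.cos (Real.pi * β) :=
    Real.cos_nonneg_of_neg_pi_div_two_le_of_le (by nlinarith) (by nlinarith)
  exact div_nonneg (by positivity) (normSq_nonneg _)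

lemma powerQuotient_log (β : ℝ) (ha : 0 < a) {p : ℝ} (hp : 0 < p) :
    powerQuotient a β (Real.log p) = ((1 / (1 + a * p ^ (-β)) : ℝ) : ℂ) := by
  have h1 : exp (β * (Real.log p : ℂ)) = ((p ^ β : ℝ) : ℂ) := by
    rw [Real.rpow_def_of_pos hp, ofReal_exp]
    push_cast
    rw [mul_comm]
  have h2 : 0 < p ^ β := Real.rpow_pos_of_pos hp β
  rw [powerQuotient, h1, Real.rpow_neg hp.le, ← ofReal_add, ← ofReal_div]
  congr 1
  field_simp

end PowerQuotient

/-! ### The power-law attenuation model -/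

section PowerLaw

variable {c a : ℝ}

lemma sqrt_powerLawQ (hc : 0 < c) (ha : 0 ≤ a) (α : ℝ) {p : ℝ} (hp : 0 < p) :
    powerLawQ c a α p ^ (1 / 2 : ℝ) = c / (1 + a * p ^ (α - 1)) := by
  have : 0 < p ^ (α - 1) := Real.rpow_pos_of_pos hp _
  rw [powerLawQ, ← div_pow, ← Real.sqrt_eq_rpow, Real.sqrt_sq (by positivity)]

lemma isCompleteBernstein_div_one_add_rpow {β : ℝ} (hc : 0 < c) (ha : 0 < a) (hβ : 0 < β)
    (hβ1 : β < 1) : IsCompleteBernstein fun p => c / (1 + a * p ^ (-β)) := by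
  refine isCompleteBernstein_of_strip (F := fun w => c * powerQuotient a β w)
    (C := c * (1 / (a * Real.sin (Real.pi * β)))) hβ hβ1
    (fun w hw => (differentiableAt_powerQuotient ha hβ hβ1 hw).const_mul _) (fun w hw => ?_)
    (fun w => ?_) (fun u => ?_) (fun p hp => ?_)
  · rw [norm_mul, Complex.norm_real, Real.norm_of_nonneg hc.le, mul_assoc]
    exact mul_le_mul_of_nonneg_left (norm_powerQuotient_le ha hβ hβ1 hw) hc.le
  · rw [powerQuotient_conj, map_mul, Complex.conj_ofReal]
  · rw [Complex.im_ofReal_mul]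
    exact mul_nonneg hc.le (powerQuotient_im_nonneg ha hβ hβ1 u)
  · rw [powerQuotient_log β ha hp, ← Complex.ofReal_mul, mul_one_div]

/-- For `β ≤ 1 / 2` the quotient has both real and imaginary part non-negative on the upper edge of
the strip, hence so has the imaginary part of its square. -/
lemma isCompleteBernstein_sq_div_one_add_rpow {β : ℝ} (c : ℝ) (ha : 0 < a) (hβ : 0 < β)
    (hβ1 : β ≤ 1 / 2) : IsCompleteBernstein fun p => c ^ 2 / (1 + a * p ^ (-β)) ^ 2 := by
  have hβ2 : β < 1 := by linarith
  have hs := sin_pi_mul_pos hβ hβ2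
  refine isCompleteBernstein_of_strip (F := fun w => (c ^ 2 : ℝ) * powerQuotient a β w ^ 2)
    (C := c ^ 2 * ((1 + 1 / Real.sin (Real.pi * β)) * (1 / (a * Real.sin (Real.pi * β))))) hβ hβ2
    (fun w hw => ((differentiableAt_powerQuotient ha hβ hβ2 hw).pow 2).const_mul _) (fun w hw => ?_)
    (fun w => ?_) (fun u => ?_) (fun p hp => ?_)
  · rw [norm_mul, Complex.norm_real, Real.norm_of_nonneg (sq_nonneg c), mul_assoc, mul_assoc,
      norm_pow, sq ‖_‖]
    exact mul_le_mul_of_nonneg_left (mul_le_mul (norm_powerQuotient_le_const ha hβ hβ2 hw)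
      (norm_powerQuotient_le ha hβ hβ2 hw) (norm_nonneg _) (by positivity)) (sq_nonneg c)
  · rw [powerQuotient_conj, map_mul, Complex.conj_ofReal, map_pow]
  · have h1 := powerQuotient_im_nonneg ha hβ hβ2 u
    have h2 := powerQuotient_re_nonneg ha hβ hβ1 u
    rw [Complex.im_ofReal_mul, sq (powerQuotient _ _ _), Complex.mul_im]
    positivity
  · rw [powerQuotient_log β ha hp, ← Complex.ofReal_pow, ← Complex.ofReal_mul, div_pow, one_pow,
      mul_one_div]

/-- The case `α = 0`, where the strip argument breaks down because `p ↦ c p / (p + a)` has its pole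
on the negative half-line; it is a multiple of a single function `p / (p + a)`. -/
lemma isCompleteBernstein_div_one_add_inv (hc : 0 < c) (ha : 0 < a) :
    IsCompleteBernstein fun p => c / (1 + a * p ^ (-1 : ℝ)) := by
  refine (isCompleteBernstein_integral_div_add (X := fun _ : Unit => a)
    (μ := c.toNNReal • Measure.dirac ()) measurable_const (fun _ => ha)
    (integrable_const _)).congr fun p hp => ?_
  have hp' : (0 : ℝ) < p := hp
  simp only [integral_smul_nnreal_measure, integral_dirac, NNReal.smul_def, smul_eq_mul,
    Real.coe_toNNReal _ hc.le, Real.rpow_neg_one]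
  field_simp

end PowerLaw

theorem mainTheorem5 (c a α : ℝ) (hc : 0 < c) (ha : 0 ≤ a) :
    (0 ≤ α → α ≤ 1 → IsCompleteBernstein (fun p : ℝ => powerLawQ c a α p ^ (1 / 2 : ℝ))) ∧
      (1 / 2 ≤ α → α ≤ 1 → IsCompleteBernstein (powerLawQ c a α)) := by
  refine ⟨fun h0 h1 => ?_, fun h0 h1 => ?_⟩
  · refine IsCompleteBernstein.congr (f := fun p => c / (1 + a * p ^ (α - 1))) ?_
      fun p hp => sqrt_powerLawQ hc ha α hp
    rcases ha.eq_or_lt with rfl | ha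
    · simpa using isCompleteBernstein_const hc.le
    rcases h1.eq_or_lt with rfl | h1
    · simpa using isCompleteBernstein_const (c := c / (1 + a)) (by positivity)
    rcases h0.eq_or_lt with rfl | h0
    · simpa using isCompleteBernstein_div_one_add_inv hc ha
    · simpa using isCompleteBernstein_div_one_add_rpow (β := 1 - α) hc ha (by linarith)
        (by linarith)
  · unfold powerLawQ
    rcases ha.eq_or_lt with rfl | ha
    · simpa using isCompleteBernstein_const (sq_nonneg c)
    rcases h1.eq_or_lt with rfl | h1
    · simpa using isCompleteBernstein_const (c := c ^ 2 / (1 + a) ^ 2) (by positivity)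
    · simpa using isCompleteBernstein_sq_div_one_add_rpow (β := 1 - α) c ha (by linarith)
        (by linarith)
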